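/- Let $X$ be a non-empty compact Hausdorff space. Then $X$ is $\mathrm I$-favorable if and only if $X$ is quasi $\kappa$-metrizable, where these notions are defined as follows. $X$ is *$\mathrm I$-favorable* if player I has a winning strategy in the open-open game, that is, there is a function $\sigma$ assigning to every finite (possibly empty) sequence of open subsets of $X$ a non-empty open subset of $X$ such that, for every sequence $(U_n)_{n\ge 0}$ of non-empty open subsets of $X$ with $U_0\subset\sigma(\varnothing)$ and $U_{n+1}\subset\sigma(U_0,\dots,U_n)$ for all $n\ge 0$, the union $\bigcup_{n\ge 0}U_n$ is dense in $X$. A set $C\subset X$ is *canonically closed* if $C=\overline{\mathrm{Int}\,C}$. A *quasi $\kappa$-metric* on $X$ is a function $\rho(x,C)\ge 0$ of a point $x\in X$ and a canonically closed set $C\subset X$ such that - (K1*) for every $C$ there is an open set $V\subset X\setminus C$, dense in $X\setminus C$, such that $\rho(x,C)=0$ if and only if $x\in X\setminus V$; - (K2) if $C\subset C'$, then $\rho(x,C')\le\rho(x,C)$ for every $x\in X$; - (K3) for every $C$ the function $x\mapsto\rho(x,C)$ is continuous on $X$; - (K4) $\rho\bigl(x,\overline{\bigcup_\alpha C_\alpha}\bigr)=\inf_\alpha\rho(x,C_\alpha)$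 for every $x\in X$ and every non-empty increasing transfinite (i.e. well-ordered) family $\{C_\alpha\}$ of canonically closed subsets of $X$. $X$ is *quasi $\kappa$-metrizable* if it admits a quasi $\kappa$-metric. -/

import Mathlib

universe u

/-- A subset of a topological space is canonically closed (regularly closed) if it is the closure
of its interior. -/
def IsCanonicallyClosed {X : Type u} [TopologicalSpace X] (C : Set X) : Prop :=
  closure (interior C) = C

/-- `σ` is a winning strategy for player I in the open-open game on `X`. The strategy assigns to
every finite sequence `(U 0, …, U (n - 1))` of previous moves of player II a nonempty open set
`σ n (U 0, …, U (n - 1))`, and whenever player II answers in every round `n` by a nonempty open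
set `U n` contained in the set just played by player I, the union of all `U n` is dense. -/
structure IsWinningStrategy {X : Type u} [TopologicalSpace X]
    (σ : (n : ℕ) → (Fin n → TopologicalSpace.Opens X) → TopologicalSpace.Opens X) : Prop where
  nonempty : ∀ (n : ℕ) (s : Fin n → TopologicalSpace.Opens X), (σ n s : Set X).Nonempty
  dense : ∀ U : ℕ → TopologicalSpace.Opens X,
    (∀ n, (U n : Set X).Nonempty) → (∀ n, U n ≤ σ n (fun i => U i)) →
      Dense (⋃ n, (U n : Set X))

/-- A space is I-favorable if player I has a winning strategy in the open-open game. -/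
def IFavorable (X : Type u) [TopologicalSpace X] : Prop :=
  ∃ σ : (n : ℕ) → (Fin n → TopologicalSpace.Opens X) → TopologicalSpace.Opens X,
    IsWinningStrategy σ

/-- `ρ` is a quasi κ-metric on `X`. Only the values `ρ x C` at canonically closed sets `C` are
relevant: the values at other sets are unconstrained and used nowhere. -/
structure IsQuasiKappaMetric {X : Type u} [TopologicalSpace X] (ρ : X → Set X → ℝ) : Prop where
  nonneg : ∀ (x : X) (C : Set X), IsCanonicallyClosed C → 0 ≤ ρ x C
  /-- K1*: the zero set of `ρ(·, C)` is the complement of an open dense subset `V` of `X \ C`. -/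
  K1star : ∀ C : Set X, IsCanonicallyClosed C →
    ∃ V : Set X, IsOpen V ∧ V ⊆ Cᶜ ∧ Cᶜ ⊆ closure V ∧ ∀ x, ρ x C = 0 ↔ x ∈ Vᶜ
  K2 : ∀ C C' : Set X, IsCanonicallyClosed C → IsCanonicallyClosed C' → C ⊆ C' →
    ∀ x, ρ x C' ≤ ρ x C
  K3 : ∀ C : Set X, IsCanonicallyClosed C → Continuous fun x => ρ x C
  /-- K4: continuity along increasing transfinite families, that is, increasing families of
  canonically closed sets indexed by a nonempty well-ordered set. -/
  K4 : ∀ (ι : Type u) [LinearOrder ι] [WellFoundedLT ι] [Nonempty ι] (C : ι → Set X),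
    (∀ i, IsCanonicallyClosed (C i)) → Monotone C →
      ∀ x, IsGLB (Set.range fun i => ρ x (C i)) (ρ x (closure (⋃ i, C i)))

/-- A space is quasi κ-metrizable if it admits a quasi κ-metric. -/
def QuasiKappaMetrizable (X : Type u) [TopologicalSpace X] : Prop :=
  ∃ ρ : X → Set X → ℝ, IsQuasiKappaMetric ρ

universe v

open TopologicalSpace Set Filter Topology
open scoped ENNReal

/-! Given a quasi κ-metric `ρ`, player I runs through all pairs `(k, q)`, playing the points more
than `1 / (q + 1)` away from the closure `D k` of the first `k` moves. If the closure `C` of all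
moves were not `X`, some `x` and `q` would satisfy `ρ x C > 1 / (q + 1)`. Dini's theorem
(compactness, K3, K4) gives a `k` with `ρ y (D k) < ρ y C + 1 / (q + 1)` for all `y`. This fails at
a point `y` of the answer in round `Nat.pair k q`, since `ρ y C = 0` there.

Conversely, `ρ x C` is read off from a function `h U x` with `U` the interior of `C`. Such an `h` is
built relative to families `M` of nonempty open sets closed under the strategy, by induction on the
cardinality of `M`. Density of the plays enters only through reductions
(`IsStrategyClosed.isReducingFamily`). For countable `M`, a supremum of weighted Urysohn functions
works. An uncountable `M` is the union of a well-ordered chain of smaller closed families. The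
supremum of their metrics need not be upper semicontinuous, so each is first lowered by `interp`
until, on unions of sets of an earlier family, it is at most half of the metric built up to that
family (`chainStep_le_half`). One stage then controls all later ones, which gives both continuity
and K4. -/

theorem isCanonicallyClosed_closure {X : Type u} [TopologicalSpace X] {U : Set X}
    (hU : IsOpen U) : IsCanonicallyClosed (closure U) :=
  Subset.antisymm (closure_minimal interior_subset isClosed_closure)
    (closure_mono hU.subset_interior_closure)

/-! ### From a quasi κ-metric to a winning strategy -/

/-- Dini's theorem for a quasi κ-metric and an increasing sequence of canonically closed sets. -/
theorem IsQuasiKappaMetric.exists_lt_add {X : Type u} [TopologicalSpace X] [CompactSpace X]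
    {ρ : X → Set X → ℝ} (hρ : IsQuasiKappaMetric ρ) {D : ℕ → Set X}
    (hD : ∀ k, IsCanonicallyClosed (D k)) (hmono : Monotone D)
    (hC : IsCanonicallyClosed (closure (⋃ k, D k))) {δ : ℝ} (hδ : 0 < δ) :
    ∃ k, ∀ y, ρ y (D k) < ρ y (closure (⋃ k, D k)) + δ := by
  set C := closure (⋃ k, D k) with hCdef
  have hglb : ∀ x, IsGLB (range fun k => ρ x (D k)) (ρ x C) := by
    intro x
    -- K4 takes index types in universe `u`, hence the lift of `ℕ`.
    have h := hρ.K4 (ULift.{u} ℕ) (fun i => D i.down) (fun i => hD _)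
      (fun i j hij => hmono hij) x
    have h1 : (⋃ i : ULift.{u} ℕ, D i.down) = ⋃ k, D k := by
      ext y; simp
    have h2 : (range fun i : ULift.{u} ℕ => ρ x (D i.down)) = range fun k => ρ x (D k) := by
      ext y; simp
    rwa [h1, h2] at h
  have hlocal : ∀ x, ∃ k, ρ x (D k) < ρ x C + δ := by
    intro x
    by_contra! hcon
    have := (hglb x).2 (show ρ x C + δ ∈ _ by rintro _ ⟨k, rfl⟩; exact hcon k)
    linarith
  choose k hk using hlocal
  have hopen : ∀ x, IsOpen {y | ρ y (D (k x)) < ρ y C + δ} := fun x =>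
    isOpen_lt (hρ.K3 _ (hD _)) ((hρ.K3 _ hC).add continuous_const)
  obtain ⟨t, ht⟩ := isCompact_univ.elim_finite_subcover _ hopen
    (fun x _ => mem_iUnion.2 ⟨x, hk x⟩)
  refine ⟨t.sup k, fun y => ?_⟩
  obtain ⟨x, hxt, hy⟩ := mem_iUnion₂.1 (ht (mem_univ y))
  exact (hρ.K2 _ _ (hD _) (hD _) (hmono (Finset.le_sup hxt)) y).trans_lt hy

open Classical in
/-- The set `W` as an open set, when it is open and nonempty, and the whole space otherwise. -/
noncomputable def openOrTop {X : Type u} [TopologicalSpace X] (W : Set X) : Opens X :=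
  if h : IsOpen W ∧ W.Nonempty then ⟨W, h.1⟩ else ⊤

theorem openOrTop_nonempty {X : Type u} [TopologicalSpace X] [Nonempty X] (W : Set X) :
    (openOrTop W : Set X).Nonempty := by
  unfold openOrTop
  split_ifs with h
  · exact h.2
  · exact univ_nonempty

theorem coe_openOrTop {X : Type u} [TopologicalSpace X] {W : Set X} (h : IsOpen W)
    (hne : W.Nonempty) : (openOrTop W : Set X) = W := by
  rw [openOrTop, dif_pos ⟨h, hne⟩]
  rfl

/-- The strategy of player I attached to a quasi κ-metric: in round `Nat.pair k q` play the set of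
the points which are `1 / (q + 1)`-far from the first `k` moves of player II. -/
noncomputable def kappaStrategy {X : Type u} [TopologicalSpace X] (ρ : X → Set X → ℝ) (n : ℕ)
    (s : Fin n → Opens X) : Opens X :=
  openOrTop {y | 1 / ((n.unpair.2 : ℝ) + 1) <
    ρ y (closure (⋃ i : Fin n, ⋃ _ : (i : ℕ) < n.unpair.1, (s i : Set X)))}

theorem QuasiKappaMetrizable.iFavorable {X : Type u} [TopologicalSpace X] [CompactSpace X]
    [Nonempty X] (h : QuasiKappaMetrizable X) : IFavorable X := by
  obtain ⟨ρ, hρ⟩ := h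
  refine ⟨kappaStrategy ρ, ⟨fun n s => openOrTop_nonempty _, fun U hUne hU => ?_⟩⟩
  set D : ℕ → Set X := fun k => closure (⋃ i, ⋃ _ : i < k, (U i : Set X)) with hDdef
  have hDc : ∀ k, IsCanonicallyClosed (D k) := fun k => isCanonicallyClosed_closure
    (isOpen_iUnion fun i => isOpen_iUnion fun _ => (U i).isOpen)
  have hDm : Monotone D := fun a b hab => closure_mono
    (iUnion_mono fun i => iUnion_subset fun hi => subset_iUnion_of_subset (hi.trans_le hab) le_rfl)
  have hUD : ∀ n, (U n : Set X) ⊆ D (n + 1) := fun n y hy =>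
    subset_closure (mem_iUnion₂.2 ⟨n, n.lt_succ_self, hy⟩)
  have hclos : closure (⋃ k, D k) = closure (⋃ n, (U n : Set X)) := by
    apply Subset.antisymm
    · refine closure_minimal (iUnion_subset fun k => closure_mono ?_) isClosed_closure
      exact iUnion_mono fun i => iUnion_subset fun _ => le_rfl
    · exact closure_mono (iUnion_subset fun n => (hUD n).trans (subset_iUnion _ _))
  have hCc : IsCanonicallyClosed (closure (⋃ k, D k)) := by
    rw [hclos]; exact isCanonicallyClosed_closure (isOpen_iUnion fun n => (U n).isOpen)
  by_contra hnd
  obtain ⟨V, hVo, hVC, hCV, hV0⟩ := hρ.K1star _ hCc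
  obtain ⟨x, hx⟩ : V.Nonempty := by
    rw [nonempty_iff_ne_empty]
    rintro rfl
    apply hnd
    rw [dense_iff_closure_eq, ← hclos]
    simpa [compl_empty_iff] using hCV
  have hxpos : 0 < ρ x (closure (⋃ k, D k)) :=
    lt_of_le_of_ne (hρ.nonneg _ _ hCc) fun h => (hV0 x).1 h.symm hx
  obtain ⟨q, hq⟩ := exists_nat_one_div_lt hxpos
  have hδ : (0 : ℝ) < 1 / ((q : ℝ) + 1) := by positivity
  obtain ⟨k, hk⟩ := hρ.exists_lt_add hDc hDm hCc hδ
  set n := Nat.pair k q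
  -- Only moves before round `n` are available to the strategy; `k ≤ Nat.pair k q` puts the first
  -- `k` moves among them.
  have hset : closure (⋃ i : Fin n, ⋃ _ : (i : ℕ) < n.unpair.1, (U i : Set X)) = D k := by
    simp only [hDdef]
    congr 1
    ext y
    simp only [mem_iUnion, n, Nat.unpair_pair]
    constructor
    · rintro ⟨i, hi, hy⟩
      exact ⟨i, hi, hy⟩
    · rintro ⟨i, hi, hy⟩
      exact ⟨⟨i, hi.trans_le (Nat.left_le_pair k q)⟩, hi, hy⟩
  have hopen : IsOpen {y | 1 / ((q : ℝ) + 1) < ρ y (D k)} :=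
    isOpen_lt continuous_const (hρ.K3 _ (hDc k))
  -- The point `x` makes the set to be played nonempty, so `openOrTop` does not fall back to the
  -- whole space.
  have hxk : 1 / ((q : ℝ) + 1) < ρ x (D k) :=
    hq.trans_le (hρ.K2 _ _ (hDc k) hCc ((subset_iUnion _ _).trans subset_closure) x)
  have hstr : (kappaStrategy ρ n (fun i => U i) : Set X) = {y | 1 / ((q : ℝ) + 1) < ρ y (D k)} := by
    have h2 : n.unpair.2 = q := by simp [n]
    rw [kappaStrategy, hset, h2]
    exact coe_openOrTop hopen ⟨x, hxk⟩
  obtain ⟨y, hy⟩ := hUne n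
  have hyW : y ∈ (kappaStrategy ρ n (fun i => U i) : Set X) := hU n hy
  rw [hstr] at hyW
  have hy0 : ρ y (closure (⋃ k, D k)) = 0 := by
    rw [hV0]
    exact fun hyV => hVC hyV (subset_closure (mem_iUnion.2 ⟨n + 1, hUD n hy⟩))
  have := hk y
  rw [hy0, zero_add] at this
  exact lt_asymm this hyW

/-! ### Reductions and relative metrics -/

/-- A family of nonempty open sets, containing the whole space and closed under nonempty
intersections, in which every nonempty open set `V` has a reduction `R`: every member of the family
below `R` meets `V`. -/
structure IsReducingFamily {X : Type u} [TopologicalSpace X] (M : Set (Opens X)) : Prop where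
  top_mem : ⊤ ∈ M
  ne_bot : ∀ U ∈ M, U ≠ ⊥
  inf_mem : ∀ U ∈ M, ∀ V ∈ M, ¬Disjoint U V → U ⊓ V ∈ M
  exists_reduction : ∀ V : Opens X, V ≠ ⊥ → ∃ R ∈ M, ∀ U ∈ M, U ≤ R → ¬Disjoint U V

/-- A quasi κ-metric relative to a family `M` of open sets: the value `h U x` is a distance from `x`
to the closure of `U`, as far as it is seen by the members of `M`. -/
structure IsRelMetric {X : Type u} [TopologicalSpace X] (M : Set (Opens X))
    (h : Opens X → X → ℝ≥0∞) : Prop where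
  le_one : ∀ U x, h U x ≤ 1
  anti : ∀ U V, (∀ W ∈ M, Disjoint W V → Disjoint W U) → ∀ x, h V x ≤ h U x
  zero : ∀ U, ∀ x ∈ U, h U x = 0
  lsc : ∀ U, LowerSemicontinuous (h U)
  usc : ∀ 𝒟 : Set (Opens X), 𝒟.Nonempty → DirectedOn (· ≤ ·) 𝒟 → ∀ x r, h (sSup 𝒟) x < r →
    ∃ U ∈ 𝒟, ∀ᶠ y in 𝓝 x, h U y < r
  pos : ∀ U, ∀ W ∈ M, Disjoint W U → ∃ W' ∈ M, W' ≤ W ∧ ∃ ε, 0 < ε ∧ ∀ x ∈ W', ε < h U x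

namespace IsRelMetric

variable {X : Type u} [TopologicalSpace X] {M : Set (Opens X)} {h : Opens X → X → ℝ≥0∞}

theorem anti_le (hh : IsRelMetric M h) {U V : Opens X} (hUV : U ≤ V) (x : X) : h V x ≤ h U x :=
  hh.anti U V (fun _ _ hW => hW.mono_right hUV) x

theorem eventually_lt (hh : IsRelMetric M h) {U : Opens X} {x : X} {r : ℝ≥0∞} (hr : h U x < r) :
    ∀ᶠ y in 𝓝 x, h U y < r := by
  obtain ⟨V, rfl, hV⟩ := hh.usc {U} (singleton_nonempty U)
    (directedOn_singleton U) x r (by rwa [sSup_singleton])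
  exact hV

theorem continuous (hh : IsRelMetric M h) (U : Opens X) : Continuous (h U) :=
  continuous_iff_lower_upperSemicontinuous.2 ⟨hh.lsc U, fun _ _ hr => hh.eventually_lt hr⟩

/-- Dini's theorem for a relative metric and a directed family of open sets. -/
theorem exists_forall_lt [CompactSpace X] (hh : IsRelMetric M h) {𝒟 : Set (Opens X)}
    (hne : 𝒟.Nonempty) (hdir : DirectedOn (· ≤ ·) 𝒟) {a b : ℝ≥0∞} (hab : a < b) :
    ∃ U ∈ 𝒟, ∀ y, h (sSup 𝒟) y ≤ a → h U y < b := by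
  have hK : IsCompact {y | h (sSup 𝒟) y ≤ a} :=
    (isClosed_le (hh.continuous _) continuous_const).isCompact
  obtain ⟨U, hU, hUy⟩ := hK.induction_on
    (p := fun s => ∃ U ∈ 𝒟, ∀ y ∈ s, h U y < b)
    (by obtain ⟨U, hU⟩ := hne; exact ⟨U, hU, by simp⟩)
    (by rintro s t hst ⟨U, hU, hUt⟩; exact ⟨U, hU, fun y hy => hUt y (hst hy)⟩)
    (by
      rintro s t ⟨U, hU, hUs⟩ ⟨V, hV, hVt⟩
      obtain ⟨W, hW, hUW, hVW⟩ := hdir U hU V hV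
      exact ⟨W, hW, fun y hy => hy.elim (fun h1 => (hh.anti_le hUW y).trans_lt (hUs y h1))
        fun h1 => (hh.anti_le hVW y).trans_lt (hVt y h1)⟩)
    (by
      intro x hx
      obtain ⟨U, hU, hUx⟩ := hh.usc 𝒟 hne hdir x b (lt_of_le_of_lt hx hab)
      exact ⟨_, mem_nhdsWithin_of_mem_nhds hUx, U, hU, fun y hy => hy⟩)
  exact ⟨U, hU, fun y hy => hUy y hy⟩

end IsRelMetric

/-! ### Interpolation between a family and a larger one -/

section Interpolation

variable {X : Type u} [TopologicalSpace X]

/-- The union of the members of `M` on which `f U` does not exceed `ε`. -/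
def nearPart (M : Set (Opens X)) (f : Opens X → X → ℝ≥0∞) (ε : ℝ≥0∞) (U : Opens X) : Opens X :=
  sSup {W | W ∈ M ∧ ∀ x ∈ W, f U x ≤ ε}

/-- The auxiliary function of the interpolation, which compares the parts of the space far from
`U`, in the sense of `f`, with the family `M` by means of `h`. -/
noncomputable def interpAux (M : Set (Opens X)) (h f : Opens X → X → ℝ≥0∞) (U : Opens X) (x : X) :
    ℝ≥0∞ :=
  ⨆ ε, min ε (h (nearPart M f ε U) x)

/-- The interpolation of a relative metric `h` for `M` and a relative metric `f` for a larger
family: a relative metric for the larger family which is at most `h / 2` on unions of members of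
`M`. -/
noncomputable def interp (M : Set (Opens X)) (h f : Opens X → X → ℝ≥0∞) (U : Opens X) (x : X) :
    ℝ≥0∞ :=
  min (f U x) (interpAux M h f U x / 2)

theorem nearPart_mono {M : Set (Opens X)} {f : Opens X → X → ℝ≥0∞} {ε δ : ℝ≥0∞}
    {U V : Opens X} (hsub : ∀ x, f U x ≤ ε → f V x ≤ δ) :
    nearPart M f ε U ≤ nearPart M f δ V :=
  sSup_le_sSup fun _ hW => ⟨hW.1, fun x hx => hsub x (hW.2 x hx)⟩

variable {M N : Set (Opens X)} {h f : Opens X → X → ℝ≥0∞}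

theorem interpAux_anti (hh : IsRelMetric M h) {U V : Opens X} (hUV : ∀ x, f V x ≤ f U x) (x : X) :
    interpAux M h f V x ≤ interpAux M h f U x :=
  iSup_mono fun _ => min_le_min le_rfl
    (hh.anti_le (nearPart_mono fun y hy => (hUV y).trans hy) x)

/-- Levels `δ ≤ ε` contribute at most `δ`; for `δ ≥ ε` the near part grows, so the value of `h`
drops. -/
theorem interpAux_le (hh : IsRelMetric M h) (U : Opens X) (ε : ℝ≥0∞) (x : X) :
    interpAux M h f U x ≤ max ε (h (nearPart M f ε U) x) := by
  refine iSup_le fun δ => ?_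
  rcases le_total δ ε with hδ | hδ
  · exact (min_le_left _ _).trans (hδ.trans (le_max_left _ _))
  · exact (min_le_right _ _).trans ((hh.anti_le (nearPart_mono fun y hy => hy.trans hδ) x).trans
      (le_max_right _ _))

/-- Take levels `a < b` between the value and `r`. By Dini for `f`, the near part of `sSup 𝒟` at
level `a` lies in that of some `U ∈ 𝒟` at level `b`, and by `interpAux_le` the single level `b`
bounds the function near `x`. -/
theorem interpAux_usc [CompactSpace X] (hh : IsRelMetric M h) (hf : IsRelMetric N f)
    {𝒟 : Set (Opens X)} (hne : 𝒟.Nonempty) (hdir : DirectedOn (· ≤ ·) 𝒟) {x : X} {r : ℝ≥0∞}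
    (hr : interpAux M h f (sSup 𝒟) x < r) :
    ∃ U ∈ 𝒟, ∀ᶠ y in 𝓝 x, interpAux M h f U y < r := by
  obtain ⟨b, hb, hbr⟩ := exists_between hr
  obtain ⟨a, ha, hab⟩ := exists_between hb
  obtain ⟨U, hU, hUy⟩ := hf.exists_forall_lt hne hdir hab
  have h1 : h (nearPart M f a (sSup 𝒟)) x < b := by
    by_contra! hcon
    have : min a (h (nearPart M f a (sSup 𝒟)) x) ≤ interpAux M h f (sSup 𝒟) x :=
      le_iSup (fun ε => min ε (h (nearPart M f ε (sSup 𝒟)) x)) a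
    rw [min_eq_left (hab.le.trans hcon)] at this
    exact this.not_gt ha
  have h2 : h (nearPart M f b U) x < b :=
    (hh.anti_le (nearPart_mono fun y hy => (hUy y hy).le) x).trans_lt h1
  refine ⟨U, hU, ?_⟩
  filter_upwards [hh.eventually_lt h2] with y hy
  exact (interpAux_le hh U b y).trans_lt ((max_eq_left hy.le).le.trans_lt hbr)

/-- Since `f (sSup s)` vanishes on every member of `s`, these members lie in the near part at every
level. -/
theorem interp_le_half (hh : IsRelMetric M h) (hf : IsRelMetric N f) {s : Set (Opens X)}
    (hs : s ⊆ M) (x : X) : interp M h f (sSup s) x ≤ h (sSup s) x / 2 := by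
  refine (min_le_right _ _).trans (ENNReal.div_le_div_right (iSup_le fun ε => ?_) 2)
  refine (min_le_right _ _).trans (hh.anti_le (sSup_le fun W hW => ?_) x)
  refine le_sSup ⟨hs hW, fun y hy => ?_⟩
  rw [hf.zero _ y (le_sSup (a := W) hW hy)]
  exact zero_le

theorem div_two_lt_iff {a b : ℝ≥0∞} : a / 2 < b ↔ a < b * 2 :=
  ENNReal.div_lt_iff (Or.inl two_ne_zero) (Or.inl ENNReal.ofNat_ne_top)

/-- If a near member `V` of `M` met `R`, then `R ⊓ V` would be a member below `R` and so meet `W`,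
where `f U` would be both `≤ ε` and `> ε`. -/
theorem disjoint_nearPart (hM : IsReducingFamily M) {U R W : Opens X} {ε : ℝ≥0∞} (hR : R ∈ M)
    (hRW : ∀ V ∈ M, V ≤ R → ¬Disjoint V W) (hW : ∀ x ∈ W, ε < f U x) :
    Disjoint R (nearPart M f ε U) := by
  refine disjoint_sSup_iff.2 fun V hV => ?_
  by_contra hdis
  refine hRW _ (hM.inf_mem R hR V hV.1 hdis) inf_le_left (Disjoint.mono_left inf_le_right ?_)
  rw [← Opens.coe_disjoint, Set.disjoint_left]
  exact fun x hxV hxW => (hV.2 x hxV).not_gt (hW x hxW)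

theorem isRelMetric_interp [CompactSpace X] (hM : IsReducingFamily M) (hN : IsReducingFamily N)
    (hMN : M ⊆ N) (hh : IsRelMetric M h) (hf : IsRelMetric N f) :
    IsRelMetric N (interp M h f) where
  le_one U x := (min_le_left _ _).trans (hf.le_one U x)
  anti U V hUV x := min_le_min (hf.anti U V hUV x)
    (ENNReal.div_le_div_right (interpAux_anti hh (hf.anti U V hUV) x) 2)
  zero U x hx := by rw [interp, hf.zero U x hx]; exact min_eq_left zero_le
  lsc U := by
    have h1 : LowerSemicontinuous (interpAux M h f U) :=
      lowerSemicontinuous_iSup fun ε =>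
        (continuous_const.min (hh.continuous (nearPart M f ε U))).lowerSemicontinuous
    intro x r hr
    obtain ⟨h2, h3⟩ := lt_min_iff.1 hr
    have h3' : r * 2 < interpAux M h f U x :=
      (ENNReal.lt_div_iff_mul_lt (Or.inl two_ne_zero) (Or.inl ENNReal.ofNat_ne_top)).1 h3
    filter_upwards [hf.lsc U x r h2, h1 x _ h3'] with y hy1 hy2
    exact lt_min hy1
      ((ENNReal.lt_div_iff_mul_lt (Or.inl two_ne_zero) (Or.inl ENNReal.ofNat_ne_top)).2 hy2)
  usc 𝒟 hne hdir x r hr := by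
    rcases min_lt_iff.1 hr with hr | hr
    · obtain ⟨U, hU, hy⟩ := hf.usc 𝒟 hne hdir x r hr
      exact ⟨U, hU, hy.mono fun y hy => (min_le_left _ _).trans_lt hy⟩
    · obtain ⟨U, hU, hy⟩ := interpAux_usc hh hf hne hdir (div_two_lt_iff.1 hr)
      exact ⟨U, hU, hy.mono fun y hy => (min_le_right _ _).trans_lt (div_two_lt_iff.2 hy)⟩
  pos U W hW hWU := by
    obtain ⟨W₁, hW₁, hW₁W, ε, hε, hεf⟩ := hf.pos U W hW hWU
    -- `W₁` need not belong to `M`; its reduction `R` does, so positivity of `h` applies to `R` and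
    -- the near part of `U`.
    obtain ⟨R, hR, hRW⟩ := hM.exists_reduction W₁ (hN.ne_bot _ hW₁)
    obtain ⟨R', hR', hR'R, δ, hδ, hδh⟩ :=
      hh.pos _ R hR (disjoint_nearPart hM hR hRW hεf)
    obtain ⟨η, hη, hηlt⟩ := exists_between
      (show 0 < min ε (min ε δ / 2) from lt_min hε (ENNReal.half_pos (lt_min hε hδ).ne'))
    refine ⟨R' ⊓ W₁, hN.inf_mem _ (hMN hR') _ hW₁ (hRW R' hR' hR'R),
      inf_le_right.trans hW₁W, η, hη, fun x hx => hηlt.trans_le ?_⟩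
    refine min_le_min (hεf x hx.2).le (ENNReal.div_le_div_right ?_ 2)
    exact (min_le_min le_rfl (hδh x hx.1).le).trans
      (le_iSup (fun ε => min ε (h (nearPart M f ε U) x)) ε)

end Interpolation

theorem IsRelMetric.sup {X : Type u} [TopologicalSpace X] {M N : Set (Opens X)}
    {h g : Opens X → X → ℝ≥0∞} (hMN : M ⊆ N) (hh : IsRelMetric M h) (hg : IsRelMetric N g) :
    IsRelMetric N (fun U x => max (h U x) (g U x)) where
  le_one U x := max_le (hh.le_one U x) (hg.le_one U x)
  anti U V hUV x := max_le_max (hh.anti U V (fun W hW => hUV W (hMN hW)) x) (hg.anti U V hUV x)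
  zero U x hx := by rw [hh.zero U x hx, hg.zero U x hx, max_self]
  lsc U := ((hh.continuous U).max (hg.continuous U)).lowerSemicontinuous
  usc 𝒟 hne hdir x r hr := by
    obtain ⟨h1, h2⟩ := max_lt_iff.1 hr
    obtain ⟨U, hU, hUx⟩ := hh.usc 𝒟 hne hdir x r h1
    obtain ⟨V, hV, hVx⟩ := hg.usc 𝒟 hne hdir x r h2
    obtain ⟨W, hW, hUW, hVW⟩ := hdir U hU V hV
    refine ⟨W, hW, ?_⟩
    filter_upwards [hUx, hVx] with y hy1 hy2
    exact max_lt ((hh.anti_le hUW y).trans_lt hy1) ((hg.anti_le hVW y).trans_lt hy2)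
  pos U W hW hWU := by
    obtain ⟨W', hW', hle, ε, hε, hεg⟩ := hg.pos U W hW hWU
    exact ⟨W', hW', hle, ε, hε, fun x hx => lt_max_of_lt_right (hεg x hx)⟩

/-! ### Gluing along a well-ordered chain of families -/

section Chain

variable {X : Type u} [TopologicalSpace X] {ι : Type v}

/-- The union of the families indexed by `J`, together with the whole space. -/
def chainFamily (N : ι → Set (Opens X)) (J : Set ι) : Set (Opens X) :=
  {⊤} ∪ ⋃ γ ∈ J, N γ

theorem subset_chainFamily {N : ι → Set (Opens X)} {J : Set ι} {γ : ι} (hγ : γ ∈ J) :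
    N γ ⊆ chainFamily N J :=
  fun _ hW => Or.inr (mem_biUnion hγ hW)

theorem exists_of_mem_chainFamily {N : ι → Set (Opens X)} {J : Set ι} (hN : ∀ γ, ⊤ ∈ N γ)
    (hJ : J.Nonempty) {W : Opens X} (hW : W ∈ chainFamily N J) : ∃ γ ∈ J, W ∈ N γ := by
  rcases hW with hW | hW
  · obtain ⟨γ, hγ⟩ := hJ
    exact ⟨γ, hγ, by rw [mem_singleton_iff.1 hW]; exact hN γ⟩
  · simpa using hW

theorem chainFamily_Iio_subset [Preorder ι] {N : ι → Set (Opens X)} (hN : ∀ γ, ⊤ ∈ N γ)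
    (hmono : Monotone N) (γ : ι) : chainFamily N (Iio γ) ⊆ N γ := by
  rintro W (hW | hW)
  · rw [mem_singleton_iff.1 hW]; exact hN γ
  · obtain ⟨β, hβ, hWβ⟩ := mem_iUnion₂.1 hW
    exact hmono (le_of_lt hβ) hWβ

/-- The union of the members of `N γ` which `chainFamily N J` cannot distinguish from parts
of `U`. -/
def chainPart (N : ι → Set (Opens X)) (J : Set ι) (γ : ι) (U : Opens X) : Opens X :=
  sSup {W | W ∈ N γ ∧ ∀ V ∈ chainFamily N J, Disjoint V U → Disjoint V W}

theorem disjoint_chainPart {N : ι → Set (Opens X)} {J : Set ι} {γ : ι} {U V : Opens X}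
    (hV : V ∈ chainFamily N J) (hVU : Disjoint V U) : Disjoint V (chainPart N J γ U) :=
  disjoint_sSup_iff.2 fun _ hW => hW.2 V hV hVU

theorem chainPart_mono [Preorder ι] {N : ι → Set (Opens X)} {J : Set ι} (hmono : Monotone N)
    {γ β : ι} (hγβ : γ ≤ β) {U V : Opens X} (hUV : U ≤ V) : chainPart N J γ U ≤ chainPart N J β V :=
  sSup_le_sSup fun _ hW => ⟨hmono hγβ hW.1, fun A hA hAV => hW.2 A hA (hAV.mono_right hUV)⟩

/-- The sets `chainPart N J γ U` exhaust `U`, as far as `chainFamily N J` can see. -/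
theorem disjoint_of_disjoint_chainPart {N : ι → Set (Opens X)} {J : Set ι} (hJ : J.Nonempty)
    (htop : ∀ γ, ⊤ ∈ N γ) (hred : IsReducingFamily (chainFamily N J)) {U W : Opens X}
    (hWU : ∀ γ ∈ J, Disjoint W (chainPart N J γ U)) :
    Disjoint W U := by
  by_contra hdis
  -- A reduction `R` of `W ⊓ U` lies in some `N γ`, and every member disjoint from `U` is disjoint
  -- from `R`. So `R` is part of `chainPart N J γ U`, yet it meets `W`.
  obtain ⟨R, hR, hRW⟩ := hred.exists_reduction (W ⊓ U) (fun h => hdis (disjoint_iff.2 h))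
  obtain ⟨γ, hγ, hRγ⟩ := exists_of_mem_chainFamily htop hJ hR
  have hle : R ≤ chainPart N J γ U := by
    refine le_sSup ⟨hRγ, fun V hV hVU => ?_⟩
    by_contra hVR
    exact hRW _ (hred.inf_mem V hV R hR hVR) inf_le_right
      (hVU.mono inf_le_left inf_le_right)
  exact hRW R hR le_rfl (((hWU γ hγ).mono_right hle).symm.mono_right inf_le_left)

variable [LinearOrder ι] [WellFoundedLT ι]

/-- The relative metrics `f γ` for the families `N γ`, corrected recursively so that they become
compatible with each other. -/
noncomputable def chainStep (N : ι → Set (Opens X)) (f : ι → Opens X → X → ℝ≥0∞) :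
    ι → Opens X → X → ℝ≥0∞ :=
  (wellFounded_lt (α := ι)).fix fun γ g => interp (chainFamily N (Iio γ))
    (fun U x => max (⨆ _ : U = ⊥, 1) (⨆ β, ⨆ hβ : β ∈ Iio γ, g β hβ U x)) (f γ)

/-- The supremum of the corrected relative metrics with index in `J`. -/
noncomputable def chainMetric (N : ι → Set (Opens X)) (f : ι → Opens X → X → ℝ≥0∞) (J : Set ι)
    (U : Opens X) (x : X) : ℝ≥0∞ :=
  -- The first term provides positivity for the member `⊤`, the only member of the family when `J`
  -- is empty.
  max (⨆ _ : U = ⊥, 1) (⨆ β ∈ J, chainStep N f β U x)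

variable {N : ι → Set (Opens X)} {f : ι → Opens X → X → ℝ≥0∞}

theorem chainStep_eq (γ : ι) :
    chainStep N f γ = interp (chainFamily N (Iio γ)) (chainMetric N f (Iio γ)) (f γ) := by
  rw [chainStep, WellFounded.fix_eq]
  rfl

theorem chainMetric_le_iff {J : Set ι} {U : Opens X} {x : X} {r : ℝ≥0∞} :
    chainMetric N f J U x ≤ r ↔ (U = ⊥ → 1 ≤ r) ∧ ∀ β ∈ J, chainStep N f β U x ≤ r := by
  simp [chainMetric]

theorem chainStep_le_chainMetric {J : Set ι} {β : ι} (hβ : β ∈ J) (U : Opens X) (x : X) :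
    chainStep N f β U x ≤ chainMetric N f J U x :=
  (chainMetric_le_iff.1 le_rfl).2 β hβ

theorem chainMetric_mono {J K : Set ι} (hJK : J ⊆ K) (U : Opens X) (x : X) :
    chainMetric N f J U x ≤ chainMetric N f K U x :=
  chainMetric_le_iff.2 ⟨(chainMetric_le_iff.1 le_rfl).1,
    fun _ hβ => chainStep_le_chainMetric (hJK hβ) U x⟩

theorem chainMetric_Iic (γ : ι) : chainMetric N f (Iic γ) =
    fun U x => max (chainMetric N f (Iio γ) U x) (chainStep N f γ U x) := by
  funext U x
  apply le_antisymm
  · refine chainMetric_le_iff.2 ⟨fun hU => le_max_of_le_left ((chainMetric_le_iff.1 le_rfl).1 hU),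
      fun β hβ => ?_⟩
    rcases eq_or_lt_of_le (show β ≤ γ from hβ) with rfl | hlt
    · exact le_max_right _ _
    · exact le_max_of_le_left (chainStep_le_chainMetric (mem_Iio.2 hlt) U x)
  · exact max_le (chainMetric_mono Iio_subset_Iic_self U x)
      (chainStep_le_chainMetric (mem_Iic.2 le_rfl) U x)

/-- On unions of members of `N γ` the corrections with index above `γ` are at most half of the
metric constructed up to `γ`. -/
theorem chainStep_le_half {J : Set ι} (hJ : IsLowerSet J) (hf : ∀ γ, IsRelMetric (N γ) (f γ))
    (hmet : ∀ γ ∈ J, IsRelMetric (chainFamily N (Iio γ)) (chainMetric N f (Iio γ)))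
    {γ : ι} {s : Set (Opens X)} (hs : s ⊆ N γ) (x : X) (β : ι) (hβ : β ∈ J) (hγβ : γ < β) :
    chainStep N f β (sSup s) x ≤ chainMetric N f (Iic γ) (sSup s) x / 2 := by
  induction β using WellFoundedLT.induction with
  | ind β ih =>
    rw [chainStep_eq]
    refine (interp_le_half (hmet β hβ) (hf β) (hs.trans (subset_chainFamily hγβ)) x).trans
      (ENNReal.div_le_div_right (chainMetric_le_iff.2
        ⟨(chainMetric_le_iff.1 le_rfl).1, fun δ hδ => ?_⟩) 2)
    -- Indices up to `γ` occur in the bound itself; those between `γ` and `β` are covered by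
    -- induction.
    rcases le_or_gt δ γ with hδγ | hδγ
    · exact chainStep_le_chainMetric (mem_Iic.2 hδγ) _ x
    · exact (ih δ hδ (hJ (le_of_lt hδ) hβ) hδγ).trans ENNReal.half_le_self

theorem isRelMetric_chainStep [CompactSpace X] (hmono : Monotone N)
    (hN : ∀ γ, IsReducingFamily (N γ)) (hred : ∀ J, IsReducingFamily (chainFamily N J))
    (hf : ∀ γ, IsRelMetric (N γ) (f γ)) {γ : ι}
    (hmet : IsRelMetric (chainFamily N (Iio γ)) (chainMetric N f (Iio γ))) :
    IsRelMetric (N γ) (chainStep N f γ) := by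
  rw [chainStep_eq]
  exact isRelMetric_interp (hred _) (hN γ)
    (chainFamily_Iio_subset (fun γ => (hN γ).top_mem) hmono γ) hmet (hf γ)

theorem isRelMetric_chainMetric_Iic [CompactSpace X] (hmono : Monotone N)
    (hN : ∀ γ, IsReducingFamily (N γ)) (hred : ∀ J, IsReducingFamily (chainFamily N J))
    (hf : ∀ γ, IsRelMetric (N γ) (f γ)) {γ : ι}
    (hmet : IsRelMetric (chainFamily N (Iio γ)) (chainMetric N f (Iio γ))) :
    IsRelMetric (N γ) (chainMetric N f (Iic γ)) := by
  rw [chainMetric_Iic]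
  exact hmet.sup (chainFamily_Iio_subset (fun γ => (hN γ).top_mem) hmono γ)
    (isRelMetric_chainStep hmono hN hred hf hmet)

section Limit

variable [CompactSpace X] (hmono : Monotone N)
    (hN : ∀ γ, IsReducingFamily (N γ)) (hred : ∀ J, IsReducingFamily (chainFamily N J))
    (hf : ∀ γ, IsRelMetric (N γ) (f γ)) {J : Set ι}
    (hmet : ∀ γ ∈ J, IsRelMetric (chainFamily N (Iio γ)) (chainMetric N f (Iio γ)))

include hmono hN hred hf hmet

theorem chainMetric_anti {U V : Opens X}
    (hUV : ∀ W ∈ chainFamily N J, Disjoint W V → Disjoint W U) (x : X) :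
    chainMetric N f J V x ≤ chainMetric N f J U x := by
  refine chainMetric_le_iff.2 ⟨fun hV => (chainMetric_le_iff.1 le_rfl).1 ?_, fun β hβ => ?_⟩
  · exact top_disjoint.1 (hUV ⊤ (hred J).top_mem (top_disjoint.2 hV))
  · exact ((isRelMetric_chainStep hmono hN hred hf (hmet β hβ)).anti U V
      (fun W hW => hUV W (subset_chainFamily hβ hW)) x).trans (chainStep_le_chainMetric hβ U x)

variable (hJ : IsLowerSet J)

include hJ

/-- If the value at the union of a directed family is small, then so is already the value at
`chainPart N J γ U` for some `γ` and some member `U` of the family, up to a factor of 2. -/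
theorem exists_chainMetric_chainPart_lt (hJne : J.Nonempty) {𝒟 : Set (Opens X)}
    (hne : 𝒟.Nonempty) (hdir : DirectedOn (· ≤ ·) 𝒟) {x : X} {r : ℝ≥0∞}
    (hr : chainMetric N f J (sSup 𝒟) x < r) :
    ∃ γ ∈ J, ∃ U ∈ 𝒟, chainMetric N f (Iic γ) (chainPart N J γ U) x < r * 2 := by
  by_contra! hcon
  have hIic := fun γ (hγ : γ ∈ J) => isRelMetric_chainMetric_Iic hmono hN hred hf (hmet γ hγ)
  set a : J × 𝒟 → ℝ≥0∞ :=
    fun p => chainMetric N f (Iic (p.1 : ι)) (chainPart N J p.1 p.2) x with ha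
  obtain ⟨γ₁, hγ₁⟩ := hJne
  obtain ⟨U₁, hU₁⟩ := hne
  have hrZ : r * 2 ≤ ⨅ p, a p := le_iInf fun p => hcon p.1 p.1.2 p.2 p.2.2
  have hZ0 : (⨅ p, a p) ≠ 0 := by
    refine (lt_of_lt_of_le ?_ hrZ).ne'
    exact ENNReal.mul_pos (lt_of_le_of_lt zero_le hr).ne' two_ne_zero
  have hZtop : (⨅ p, a p) ≠ ⊤ :=
    ((iInf_le a (⟨γ₁, hγ₁⟩, ⟨U₁, hU₁⟩)).trans_lt
      (((hIic γ₁ hγ₁).le_one _ x).trans_lt ENNReal.one_lt_top)).ne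
  have hvZ : chainMetric N f J (sSup 𝒟) x < ⨅ p, a p :=
    hr.trans_le (le_trans (by rw [mul_two]; exact le_self_add) hrZ)
  -- With `Z` the infimum of `a`: `q > Z / 2` yields an index with `a / 2 < q`, and `q` exceeds the
  -- value at `sSup 𝒟`. The contradiction will be an index `m` with `a m ≤ q < Z`.
  obtain ⟨q, hq, hqZ⟩ := exists_between (max_lt (ENNReal.half_lt_self hZ0 hZtop) hvZ)
  obtain ⟨hq1, hq2⟩ := max_lt_iff.1 hq
  obtain ⟨⟨⟨γ₀, hγ₀⟩, ⟨U₀, hU₀⟩⟩, ha0⟩ := iInf_lt_iff.1 (div_two_lt_iff.1 hq1)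
  have ha0' : a (⟨γ₀, hγ₀⟩, ⟨U₀, hU₀⟩) / 2 < q := div_two_lt_iff.2 ha0
  set ℰ : Set (Opens X) := range fun p : J × 𝒟 => chainPart N J p.1 p.2
  have hub : ∀ p q : J × 𝒟, ∃ m : J × 𝒟, (p.1 ≤ m.1 ∧ (p.2 : Opens X) ≤ m.2) ∧
      q.1 ≤ m.1 ∧ (q.2 : Opens X) ≤ m.2 := by
    rintro ⟨γ, U, hU⟩ ⟨β, V, hV⟩
    obtain ⟨W, hW, hUW, hVW⟩ := hdir U hU V hV
    exact ⟨(max γ β, ⟨W, hW⟩), ⟨le_max_left _ _, hUW⟩, le_max_right _ _, hVW⟩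
  have hEdir : DirectedOn (· ≤ ·) ℰ := by
    rintro _ ⟨p, rfl⟩ _ ⟨q, rfl⟩
    obtain ⟨m, hm1, hm2⟩ := hub p q
    exact ⟨_, ⟨m, rfl⟩, chainPart_mono hmono hm1.1 hm1.2, chainPart_mono hmono hm2.1 hm2.2⟩
  -- A member of the chain missing all the parts misses all of `𝒟`, so passing to the parts does not
  -- raise the value.
  have hEle : chainMetric N f J (sSup ℰ) x ≤ chainMetric N f J (sSup 𝒟) x := by
    refine chainMetric_anti hmono hN hred hf hmet (fun W hW hWE => ?_) x
    refine disjoint_sSup_iff.2 fun U hU => ?_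
    refine disjoint_of_disjoint_chainPart ⟨γ₁, hγ₁⟩ (fun γ => (hN γ).top_mem) (hred J)
      fun γ hγ => disjoint_sSup_iff.1 hWE _ ⟨(⟨γ, hγ⟩, ⟨U, hU⟩), rfl⟩
  obtain ⟨_, ⟨p, rfl⟩, hp⟩ := (hIic γ₀ hγ₀).usc ℰ ⟨_, (⟨γ₁, hγ₁⟩, ⟨U₁, hU₁⟩), rfl⟩ hEdir x q
    (((chainMetric_mono (fun β hβ => hJ hβ hγ₀) _ x).trans hEle).trans_lt hq2)
  obtain ⟨m, hm1, hm2⟩ := hub p (⟨γ₀, hγ₀⟩, ⟨U₀, hU₀⟩)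
  have hlow : chainMetric N f (Iic γ₀) (chainPart N J m.1 m.2) x ≤ q :=
    ((hIic γ₀ hγ₀).anti_le (chainPart_mono hmono hm1.1 hm1.2) x).trans hp.self_of_nhds.le
  have hle : a m ≤ q := by
    refine chainMetric_le_iff.2 ⟨(chainMetric_le_iff.1 hlow).1, fun β hβ => ?_⟩
    -- Indices up to `γ₀` are small by semicontinuity at stage `γ₀`; for later ones the value is at
    -- most half of `a` at `(γ₀, U₀)`.
    rcases le_or_gt β γ₀ with hβγ | hβγ
    · exact (chainMetric_le_iff.1 hlow).2 β hβγ
    · have hβJ : β ∈ J := hJ hβ m.1.2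
      refine ((isRelMetric_chainStep hmono hN hred hf (hmet β hβJ)).anti_le
        (chainPart_mono hmono hm2.1 hm2.2) x).trans (le_trans ?_ ha0'.le)
      exact chainStep_le_half hJ hf hmet (fun W hW => hW.1) x β hβJ hβγ
  exact (hqZ.trans_le (iInf_le a m)).not_ge hle

/-- One index `γ` suffices. Indices up to `γ` are handled by semicontinuity of the metric at stage
`γ`. For later ones, comparison with `chainPart N J γ U`, a union of members of `N γ`, bounds them
by half of the metric at stage `γ`. -/
theorem chainMetric_usc {𝒟 : Set (Opens X)} (hne : 𝒟.Nonempty) (hdir : DirectedOn (· ≤ ·) 𝒟)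
    (x : X) (r : ℝ≥0∞) (hr : chainMetric N f J (sSup 𝒟) x < r) :
    ∃ U ∈ 𝒟, ∀ᶠ y in 𝓝 x, chainMetric N f J U y < r := by
  have hIic := fun γ (hγ : γ ∈ J) => isRelMetric_chainMetric_Iic hmono hN hred hf (hmet γ hγ)
  rcases J.eq_empty_or_nonempty with rfl | hJne
  · by_cases hbot : ∃ U ∈ 𝒟, U ≠ ⊥
    · obtain ⟨U, hU, hUne⟩ := hbot
      refine ⟨U, hU, Eventually.of_forall fun y => lt_of_le_of_lt ?_ hr⟩
      exact chainMetric_le_iff.2 ⟨fun h => absurd h hUne, by simp⟩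
    · push Not at hbot
      have : sSup 𝒟 = ⊥ := sSup_eq_bot.2 hbot
      obtain ⟨U, hU⟩ := hne
      refine ⟨U, hU, Eventually.of_forall fun y => lt_of_le_of_lt ?_ hr⟩
      exact chainMetric_le_iff.2 ⟨fun _ => (chainMetric_le_iff.1 le_rfl).1 this, by simp⟩
  obtain ⟨q, hq, hqr⟩ := exists_between hr
  obtain ⟨γ, hγ, U, hU, hUq⟩ :=
    exists_chainMetric_chainPart_lt hmono hN hred hf hmet hJ hJne hne hdir hq
  obtain ⟨V, hV, hVq⟩ := (hIic γ hγ).usc 𝒟 hne hdir x q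
    ((chainMetric_mono (fun β hβ => hJ hβ hγ) _ x).trans_lt hq)
  obtain ⟨W, hW, hUW, hVW⟩ := hdir U hU V hV
  refine ⟨W, hW, ?_⟩
  filter_upwards [(hIic γ hγ).eventually_lt hUq, hVq] with y hyU hyV
  have hlow : chainMetric N f (Iic γ) W y ≤ q := ((hIic γ hγ).anti_le hVW y).trans hyV.le
  refine (chainMetric_le_iff.2 ⟨(chainMetric_le_iff.1 hlow).1, fun β hβ => ?_⟩).trans_lt hqr
  rcases le_or_gt β γ with hβγ | hβγ
  · exact (chainMetric_le_iff.1 hlow).2 β hβγ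
  · refine ((isRelMetric_chainStep hmono hN hred hf (hmet β hβ)).anti (chainPart N J γ U) W
      (fun A hA hAW => disjoint_chainPart (subset_chainFamily hβ hA) (hAW.mono_right hUW))
      y).trans ((chainStep_le_half hJ hf hmet (fun W hW => hW.1) y β hβ hβγ).trans ?_)
    exact (div_two_lt_iff.2 hyU).le

theorem isRelMetric_chainMetric : IsRelMetric (chainFamily N J) (chainMetric N f J) where
  le_one U x := chainMetric_le_iff.2 ⟨fun _ => le_rfl,
    fun β hβ => (isRelMetric_chainStep hmono hN hred hf (hmet β hβ)).le_one U x⟩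
  anti U V hUV x := chainMetric_anti hmono hN hred hf hmet hUV x
  zero U x hx := by
    refine le_antisymm (chainMetric_le_iff.2 ⟨?_, fun β hβ => ?_⟩) zero_le
    · rintro rfl
      exact hx.elim
    · rw [(isRelMetric_chainStep hmono hN hred hf (hmet β hβ)).zero U x hx]
  lsc U := by
    refine LowerSemicontinuous.sup lowerSemicontinuous_const ?_
    exact lowerSemicontinuous_iSup fun β => lowerSemicontinuous_iSup fun hβ =>
      (isRelMetric_chainStep hmono hN hred hf (hmet β hβ)).lsc U
  usc 𝒟 hne hdir x r hr := chainMetric_usc hmono hN hred hf hmet hJ hne hdir x r hr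
  pos U W hW hWU := by
    rcases hW with hW | hW
    · rw [mem_singleton_iff.1 hW] at hWU ⊢
      refine ⟨⊤, (hred J).top_mem, le_rfl, 1 / 2, by simp, fun x _ => ?_⟩
      exact lt_of_lt_of_le (by simp)
        ((chainMetric_le_iff.1 (le_refl (chainMetric N f J U x))).1 (top_disjoint.1 hWU))
    · obtain ⟨β, hβ, hWβ⟩ := mem_iUnion₂.1 hW
      obtain ⟨W', hW', hle, ε, hε, hlt⟩ :=
        (isRelMetric_chainStep hmono hN hred hf (hmet β hβ)).pos U W hWβ hWU
      exact ⟨W', subset_chainFamily hβ hW', hle, ε, hε,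
        fun x hx => (hlt x hx).trans_le (chainStep_le_chainMetric hβ U x)⟩

end Limit

/-- Relative metrics for the members of a well-ordered chain of families yield a relative metric for
the union of the chain. -/
theorem exists_isRelMetric_chain [CompactSpace X] (hmono : Monotone N)
    (hN : ∀ γ, IsReducingFamily (N γ)) (hred : ∀ J, IsReducingFamily (chainFamily N J))
    (hf : ∀ γ, IsRelMetric (N γ) (f γ)) : ∃ h, IsRelMetric (chainFamily N univ) h := by
  have hmet : ∀ γ, IsRelMetric (chainFamily N (Iio γ)) (chainMetric N f (Iio γ)) := fun γ => by
    induction γ using WellFoundedLT.induction with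
    | ind γ ih => exact isRelMetric_chainMetric hmono hN hred hf ih (isLowerSet_Iio γ)
  exact ⟨_, isRelMetric_chainMetric hmono hN hred hf (fun γ _ => hmet γ) isLowerSet_univ⟩

end Chain

/-! ### Countable families: Urysohn functions -/

section CountableFamily

variable {X : Type u} [TopologicalSpace X]

/-- The relative metric attached to a sequence of functions `ψ n` vanishing outside of `W n`. -/
noncomputable def seqMetric (W : ℕ → Opens X) (ψ : ℕ → X → ℝ≥0∞) (U : Opens X) (x : X) : ℝ≥0∞ :=
  ⨆ n, ⨆ _ : Disjoint (W n) U, ψ n x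

variable {W : ℕ → Opens X} {ψ : ℕ → X → ℝ≥0∞}

theorem seqMetric_le_iff {U : Opens X} {x : X} {r : ℝ≥0∞} :
    seqMetric W ψ U x ≤ r ↔ ∀ n, Disjoint (W n) U → ψ n x ≤ r := by
  simp [seqMetric]

theorem le_seqMetric {U : Opens X} {n : ℕ} (h : Disjoint (W n) U) (x : X) :
    ψ n x ≤ seqMetric W ψ U x :=
  seqMetric_le_iff.1 le_rfl n h

/-- Only finitely many `n` matter, because `2⁻¹ ^ n` tends to zero. For each of these, if `W n`
meets `sSup 𝒟`, it already meets some member of `𝒟`. -/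
theorem seqMetric_usc (hψ : ∀ n, Continuous (ψ n)) (hle : ∀ n x, ψ n x ≤ 2⁻¹ ^ n)
    {𝒟 : Set (Opens X)} (hne : 𝒟.Nonempty) (hdir : DirectedOn (· ≤ ·) 𝒟) (x : X) (r : ℝ≥0∞)
    (hr : seqMetric W ψ (sSup 𝒟) x < r) : ∃ U ∈ 𝒟, ∀ᶠ y in 𝓝 x, seqMetric W ψ U y < r := by
  obtain ⟨q, hq, hqr⟩ := exists_between hr
  have hlim : Tendsto (fun n : ℕ => (2⁻¹ : ℝ≥0∞) ^ n) atTop (𝓝 0) :=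
    ENNReal.tendsto_pow_atTop_nhds_zero_of_lt_one (by simp)
  obtain ⟨K, hK⟩ := eventually_atTop.1 (hlim.eventually_lt_const (lt_of_le_of_lt zero_le hq))
  have hfin : ∀ k : ℕ, ∃ U ∈ 𝒟, ∀ᶠ y in 𝓝 x, ∀ n < k, Disjoint (W n) U → ψ n y ≤ q := by
    intro k
    induction k with
    | zero => obtain ⟨U, hU⟩ := hne; exact ⟨U, hU, by simp⟩
    | succ k ih =>
      obtain ⟨U, hU, hUy⟩ := ih
      obtain ⟨V, hV, hVy⟩ : ∃ V ∈ 𝒟, ∀ᶠ y in 𝓝 x, Disjoint (W k) V → ψ k y ≤ q := by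
        by_cases hdis : Disjoint (W k) (sSup 𝒟)
        · refine ⟨U, hU, ?_⟩
          filter_upwards [(hψ k).continuousAt.eventually_lt_const
            ((le_seqMetric hdis x).trans_lt hq)] with y hy _ using hy.le
        · rw [disjoint_sSup_iff] at hdis
          push Not at hdis
          obtain ⟨V, hV, hVd⟩ := hdis
          exact ⟨V, hV, Eventually.of_forall fun y h => absurd h hVd⟩
      obtain ⟨A, hA, hUA, hVA⟩ := hdir U hU V hV
      refine ⟨A, hA, ?_⟩
      filter_upwards [hUy, hVy] with y hy1 hy2 n hn hdis
      rcases Nat.lt_succ_iff_lt_or_eq.1 hn with h | rfl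
      · exact hy1 n h (hdis.mono_right hUA)
      · exact hy2 (hdis.mono_right hVA)
  obtain ⟨U, hU, hUy⟩ := hfin K
  refine ⟨U, hU, hUy.mono fun y hy => (seqMetric_le_iff.2 fun n hn => ?_).trans_lt hqr⟩
  rcases lt_or_ge n K with h | h
  · exact hy n h hn
  · exact (hle n y).trans (hK n h).le

theorem isRelMetric_seqMetric (hψ : ∀ n, Continuous (ψ n)) (hle : ∀ n x, ψ n x ≤ 2⁻¹ ^ n)
    (hzero : ∀ n x, x ∉ W n → ψ n x = 0)
    (hpos : ∀ n, ∃ W' ∈ range W, W' ≤ W n ∧ ∃ ε, 0 < ε ∧ ∀ x ∈ W', ε < ψ n x) :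
    IsRelMetric (range W) (seqMetric W ψ) where
  le_one U x := seqMetric_le_iff.2 fun n _ =>
    (hle n x).trans (pow_le_one₀ zero_le (by simp))
  anti U V hUV x := seqMetric_le_iff.2 fun n hn => le_seqMetric (hUV _ ⟨n, rfl⟩ hn) x
  zero U x hx := by
    refine le_antisymm (seqMetric_le_iff.2 fun n hn => ?_) zero_le
    rw [← Opens.coe_disjoint] at hn
    rw [hzero n x (hn.notMem_of_mem_right hx)]
  lsc U := lowerSemicontinuous_iSup fun n => lowerSemicontinuous_iSup fun _ =>
    (hψ n).lowerSemicontinuous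
  usc 𝒟 hne hdir x r hr := seqMetric_usc hψ hle hne hdir x r hr
  pos := by
    rintro U _ ⟨n, rfl⟩ hU
    obtain ⟨W', hW', hW'le, ε, hε, hlt⟩ := hpos n
    exact ⟨W', hW', hW'le, ε, hε, fun x hx => (hlt x hx).trans_le (le_seqMetric hU x)⟩

theorem exists_isRelMetric_of_countable [NormalSpace X] {M : Set (Opens X)}
    (hM : M.Countable) (hne : M.Nonempty)
    (hshrink : ∀ W ∈ M, ∃ W' ∈ M, closure (W' : Set X) ⊆ W) :
    ∃ h, IsRelMetric M h := by
  obtain ⟨W, rfl⟩ := hM.exists_eq_range hne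
  choose W' hW' hcl using fun n => hshrink (W n) ⟨n, rfl⟩
  have hury : ∀ n, ∃ φ : C(X, ℝ), EqOn φ 0 (W n : Set X)ᶜ ∧ EqOn φ 1 (closure (W' n : Set X)) ∧
      ∀ x, φ x ∈ Icc (0 : ℝ) 1 := fun n =>
    exists_continuous_zero_one_of_isClosed (W n).isOpen.isClosed_compl isClosed_closure
      (disjoint_compl_left_iff_subset.2 (hcl n))
  choose φ hφ0 hφ1 hφ using hury
  refine ⟨_, isRelMetric_seqMetric (W := W) (ψ := fun n x => ENNReal.ofReal (φ n x) * 2⁻¹ ^ n)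
    (fun n => ?_) (fun n x => ?_) (fun n x hx => ?_) fun n => ?_⟩
  · exact (ENNReal.continuous_mul_const (ENNReal.pow_ne_top (by simp))).comp
      (ENNReal.continuous_ofReal.comp (φ n).continuous)
  · exact mul_le_of_le_one_left zero_le (ENNReal.ofReal_le_one.2 (hφ n x).2)
  · simp [hφ0 n hx]
  · have hpow : (2⁻¹ : ℝ≥0∞) ^ n ≠ 0 := pow_ne_zero _ (by simp)
    refine ⟨W' n, hW' n, fun x hx => hcl n (subset_closure hx), 2⁻¹ ^ n / 2,
      ENNReal.half_pos hpow, fun x hx => ?_⟩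
    simpa [hφ1 n (subset_closure hx)] using
      ENNReal.half_lt_self hpow (ENNReal.pow_ne_top (by simp))

end CountableFamily

/-! ### Closure under countably many finitary operations -/

section FinClosure

variable {A : Type u}

/-- The closure of a set under countably many finitary operations. -/
inductive FinClosure (F : ℕ → List A → A) (S : Set A) : A → Prop
  | base (a : A) : a ∈ S → FinClosure F S a
  | op (n : ℕ) (l : List A) : (∀ a ∈ l, FinClosure F S a) → FinClosure F S (F n l)

theorem FinClosure.mono {F : ℕ → List A → A} {S T : Set A} (hST : S ⊆ T) {a : A}
    (ha : FinClosure F S a) : FinClosure F T a := by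
  induction ha with
  | base a ha => exact .base a (hST ha)
  | op n l _ ih => exact .op n l ih

theorem FinClosure.mem {F : ℕ → List A → A} {S T : Set A} (hST : S ⊆ T)
    (hT : ∀ n l, (∀ a ∈ l, a ∈ T) → F n l ∈ T) {a : A} (ha : FinClosure F S a) : a ∈ T := by
  induction ha with
  | base a ha => exact hST ha
  | op n l _ ih => exact hT n l ih

/-- The finite stages of the construction of `FinClosure F S`. -/
def finStage (F : ℕ → List A → A) (S : Set A) : ℕ → Set A
  | 0 => S
  | n + 1 => finStage F S n ∪
      range fun p : ℕ × List (finStage F S n) => F p.1 (p.2.map Subtype.val)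

theorem finStage_mono (F : ℕ → List A → A) (S : Set A) : Monotone (finStage F S) :=
  monotone_nat_of_le_succ fun _ => subset_union_left

open Cardinal in
theorem mk_finStage_le (F : ℕ → List A → A) (S : Set A) (n : ℕ) :
    #(finStage F S n) ≤ max ℵ₀ #S := by
  induction n with
  | zero => exact le_max_right _ _
  | succ n ih =>
    have h0 : ℵ₀ ≤ max ℵ₀ #S := le_max_left _ _
    refine (mk_union_le _ _).trans (add_le_of_le h0 ih (mk_range_le.trans ?_))
    rw [mk_prod, lift_uzero, mk_nat, lift_aleph0]
    exact mul_le_of_le h0 h0 ((mk_list_le_max _).trans (max_le h0 ih))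

open Cardinal in
theorem mk_finClosure_le (F : ℕ → List A → A) (S : Set A) :
    #{a | FinClosure F S a} ≤ max ℵ₀ #S := by
  have hsub : {a | FinClosure F S a} ⊆ ⋃ n : ULift.{u} ℕ, finStage F S n.down := by
    intro a ha
    refine FinClosure.mem (fun b hb => mem_iUnion.2 ⟨⟨0⟩, hb⟩) (fun m l hl => ?_) ha
    have hstage : ∃ n, ∀ b ∈ l, b ∈ finStage F S n := by
      clear ha
      induction l with
      | nil => exact ⟨0, by simp⟩
      | cons b l ih =>
        obtain ⟨n, hn⟩ := ih fun c hc => hl c (List.mem_cons_of_mem _ hc)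
        obtain ⟨k, hk⟩ := mem_iUnion.1 (hl b List.mem_cons_self)
        refine ⟨max n k.down, List.forall_mem_cons.2 ⟨?_, fun c hc => ?_⟩⟩
        · exact finStage_mono F S (le_max_right _ _) hk
        · exact finStage_mono F S (le_max_left _ _) (hn c hc)
    obtain ⟨n, hn⟩ := hstage
    lift l to List (finStage F S n) using hn
    exact mem_iUnion.2 ⟨⟨n + 1⟩, Or.inr ⟨(m, l), rfl⟩⟩
  refine (mk_le_mk_of_subset hsub).trans ((mk_iUnion_le _).trans ?_)
  rw [mk_uLift, mk_nat, lift_aleph0]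
  exact mul_le_of_le (le_max_left _ _) (le_max_left _ _)
    (ciSup_le' fun n => mk_finStage_le F S n.down)

end FinClosure

/-! ### Families closed under the strategy -/

section StrategyClosed

variable {X : Type u} [TopologicalSpace X]

/-- A family of nonempty open sets closed under the strategy `σ`, under nonempty intersections and
under passing to some smaller open set with closure in the given one. -/
structure IsStrategyClosed (σ : (n : ℕ) → (Fin n → Opens X) → Opens X) (M : Set (Opens X)) :
    Prop where
  top_mem : ⊤ ∈ M
  ne_bot : ∀ U ∈ M, U ≠ ⊥
  inf_mem : ∀ U ∈ M, ∀ V ∈ M, ¬Disjoint U V → U ⊓ V ∈ M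
  exists_shrink : ∀ W ∈ M, ∃ W' ∈ M, closure (W' : Set X) ⊆ W
  strategy_mem : ∀ (n : ℕ) (s : Fin n → Opens X), (∀ i, s i ∈ M) → σ n s ∈ M

variable {σ : (n : ℕ) → (Fin n → Opens X) → Opens X} {M : Set (Opens X)}

theorem IsStrategyClosed.exists_play (hM : IsStrategyClosed σ M) (G : M → M) :
    ∃ u : ℕ → M, ∀ n, u n = G ⟨σ n fun i => (u i : Opens X), hM.strategy_mem n _ fun i => (u i).2⟩ :=
  ⟨(wellFounded_lt (α := ℕ)).fix fun n u =>
      G ⟨σ n fun i => (u i i.2 : Opens X), hM.strategy_mem n _ fun i => (u i i.2).2⟩,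
    fun n => by rw [WellFounded.fix_eq]⟩

/-- If `V` had no reduction, player II could answer each move `R ∈ M` by a member of `M` below `R`
and disjoint from `V`. The play would stay in `M` and its union would miss `V`. -/
theorem IsStrategyClosed.isReducingFamily (hσ : IsWinningStrategy σ) (hM : IsStrategyClosed σ M) :
    IsReducingFamily M where
  top_mem := hM.top_mem
  ne_bot := hM.ne_bot
  inf_mem := hM.inf_mem
  exists_reduction V hV := by
    by_contra! hcon
    choose G hGM hGle hGV using hcon
    obtain ⟨u, hu⟩ := hM.exists_play fun R => ⟨G R R.2, hGM R R.2⟩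
    have hdense := hσ.dense (fun n => u n)
      (fun n => (Opens.ne_bot_iff_nonempty _).1 (hM.ne_bot _ (u n).2))
      (fun n => by
        conv_lhs => rw [hu n]
        exact hGle _ _)
    obtain ⟨x, hxV, hx⟩ := hdense.inter_open_nonempty V V.isOpen
      ((Opens.ne_bot_iff_nonempty _).1 hV)
    obtain ⟨n, hn⟩ := mem_iUnion.1 hx
    have hdis : Disjoint (u n : Opens X) V := by
      rw [hu n]
      exact hGV _ _
    rw [← Opens.coe_disjoint] at hdis
    exact hdis.notMem_of_mem_left hn hxV

theorem isStrategyClosed_iUnion {ι : Type v} [LinearOrder ι] {N : ι → Set (Opens X)}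
    (hmono : Monotone N) (hN : ∀ γ, IsStrategyClosed σ (N γ)) {J : Set ι} (hJ : J.Nonempty) :
    IsStrategyClosed σ (⋃ γ ∈ J, N γ) where
  top_mem := by
    obtain ⟨γ, hγ⟩ := hJ
    exact mem_biUnion hγ (hN γ).top_mem
  ne_bot U hU := by
    obtain ⟨γ, _, hγ⟩ := mem_iUnion₂.1 hU
    exact (hN γ).ne_bot U hγ
  inf_mem U hU V hV hUV := by
    obtain ⟨γ, hγJ, hγ⟩ := mem_iUnion₂.1 hU
    obtain ⟨β, hβJ, hβ⟩ := mem_iUnion₂.1 hV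
    rcases le_total γ β with h | h
    · exact mem_biUnion hβJ ((hN β).inf_mem U (hmono h hγ) V hβ hUV)
    · exact mem_biUnion hγJ ((hN γ).inf_mem U hγ V (hmono h hβ) hUV)
  exists_shrink W hW := by
    obtain ⟨γ, hγJ, hγ⟩ := mem_iUnion₂.1 hW
    obtain ⟨W', hW', hcl⟩ := (hN γ).exists_shrink W hγ
    exact ⟨W', mem_biUnion hγJ hW', hcl⟩
  strategy_mem n s hs := by
    have hs' : ∀ i, ∃ γ : J, s i ∈ N γ := fun i => by
      obtain ⟨γ, hγJ, hγ⟩ := mem_iUnion₂.1 (hs i)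
      exact ⟨⟨γ, hγJ⟩, hγ⟩
    choose γ hγ using hs'
    have : Nonempty J := hJ.to_subtype
    obtain ⟨β, hβ⟩ := Finite.exists_le γ
    exact mem_biUnion β.2 ((hN β).strategy_mem n s fun i => hmono (hβ i) (hγ i))

theorem isReducingFamily_chainFamily [Nonempty X] (hσ : IsWinningStrategy σ) {ι : Type v}
    [LinearOrder ι] {N : ι → Set (Opens X)} (hmono : Monotone N)
    (hN : ∀ γ, IsStrategyClosed σ (N γ)) (J : Set ι) : IsReducingFamily (chainFamily N J) := by
  rcases J.eq_empty_or_nonempty with rfl | hJ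
  -- The family `{⊤}` need not be closed under `σ`, so empty `J` is treated directly.
  · have h : chainFamily N ∅ = {⊤} := by simp [chainFamily]
    rw [h]
    exact
      { top_mem := rfl
        ne_bot := by rintro _ rfl; exact top_ne_bot
        inf_mem := by rintro _ rfl _ rfl _; simp
        exists_reduction := fun V hV => ⟨⊤, rfl, by rintro _ rfl _; rwa [top_disjoint]⟩ }
  · have hcl := isStrategyClosed_iUnion hmono hN hJ
    have h : chainFamily N J = ⋃ γ ∈ J, N γ :=
      union_eq_self_of_subset_left (singleton_subset_iff.2 hcl.top_mem)
    rw [h]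
    exact hcl.isReducingFamily hσ

open Cardinal in
/-- The closure of a subset `S` of a closed family, of cardinality at most `max ℵ₀ #S` and
monotone in `S`. -/
theorem IsStrategyClosed.exists_closure (hM : IsStrategyClosed σ M) :
    ∃ C : Set (Opens X) → Set (Opens X), Monotone C ∧ ∀ S ⊆ M,
      S ⊆ C S ∧ C S ⊆ M ∧ IsStrategyClosed σ (C S) ∧ #(C S) ≤ max ℵ₀ #S := by
  classical
  choose! η hη hηcl using hM.exists_shrink
  -- Missing list entries are read as `⊤`, and disjoint pairs are sent to `⊤`, so that all
  -- operations preserve `M`; `F 0 []` supplies `⊤` itself.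
  let F : ℕ → List (Opens X) → Opens X
    | 0 => fun l => if Disjoint (l.getD 0 ⊤) (l.getD 1 ⊤) then ⊤ else l.getD 0 ⊤ ⊓ l.getD 1 ⊤
    | 1 => fun l => η (l.getD 0 ⊤)
    | n + 2 => fun l => σ n fun i => l.getD i ⊤
  have hget : ∀ l : List (Opens X), (∀ a ∈ l, a ∈ M) → ∀ i, l.getD i ⊤ ∈ M := by
    intro l hl i
    rcases lt_or_ge i l.length with h | h
    · rw [List.getD_eq_getElem _ _ h]; exact hl _ (List.getElem_mem h)
    · rw [List.getD_eq_default _ _ h]; exact hM.top_mem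
  have hF : ∀ n l, (∀ a ∈ l, a ∈ M) → F n l ∈ M := by
    intro n l hl
    match n with
    | 0 =>
      change (if _ then _ else _) ∈ M
      split_ifs with h
      · exact hM.top_mem
      · exact hM.inf_mem _ (hget l hl 0) _ (hget l hl 1) h
    | 1 => exact hη _ (hget l hl 0)
    | n + 2 => exact hM.strategy_mem n _ fun i => hget l hl i
  refine ⟨fun S => {a | FinClosure F S a}, fun S T hST a ha => ha.mono hST, fun S hS => ?_⟩
  have hsub : {a | FinClosure F S a} ⊆ M := fun a ha => ha.mem hS hF
  refine ⟨fun a ha => .base a ha, hsub, ⟨?_, fun U hU => hM.ne_bot U (hsub hU), ?_, ?_, ?_⟩,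
    mk_finClosure_le F S⟩
  · have h : F 0 [] = ⊤ := by simp [F]
    rw [← h]
    exact .op 0 [] (by simp)
  · intro U hU V hV hUV
    have h : F 0 [U, V] = U ⊓ V := by simp [F, hUV]
    rw [← h]
    refine .op 0 [U, V] ?_
    simpa using ⟨hU, hV⟩
  · intro W hW
    refine ⟨η W, ?_, hηcl W (hsub hW)⟩
    have h : F 1 [W] = η W := by simp [F]
    rw [← h]
    refine .op 1 [W] ?_
    simpa using hW
  · intro n s hs
    have h : F (n + 2) (List.ofFn s) = σ n s := by simp [F]
    rw [← h]
    refine .op (n + 2) (List.ofFn s) ?_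
    simpa [List.mem_ofFn] using hs

open Cardinal in
/-- Every closed family has a relative metric, by induction on its cardinality. -/
theorem IsStrategyClosed.exists_isRelMetric [CompactSpace X] [T2Space X] [Nonempty X]
    (hσ : IsWinningStrategy σ) (hM : IsStrategyClosed σ M) : ∃ h, IsRelMetric M h := by
  induction hκ : #M using WellFoundedLT.induction generalizing M with
  | ind κ ih =>
    rcases le_or_gt #M ℵ₀ with hle | hgt
    · exact exists_isRelMetric_of_countable (le_aleph0_iff_set_countable.1 hle) ⟨⊤, hM.top_mem⟩
        hM.exists_shrink
    obtain ⟨C, hCmono, hC⟩ := hM.exists_closure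
    obtain ⟨e⟩ : Nonempty ((#M).ord.ToType ≃ M) := Cardinal.eq.1 (mk_ord_toType _)
    -- Indexing `M` by its initial ordinal makes every initial segment smaller than `M`; as `M` is
    -- uncountable, so are the closures of these segments.
    set S : (#M).ord.ToType → Set (Opens X) := fun γ => (fun β => (e β : Opens X)) '' Iic γ
    have hS : ∀ γ, S γ ⊆ M := by
      rintro γ _ ⟨β, -, rfl⟩
      exact (e β).2
    have hSmono : Monotone S := fun γ β h => image_mono (Iic_subset_Iic.2 h)
    have hcard : ∀ γ, #(C (S γ)) < κ := by
      intro γ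
      rw [← hκ]
      refine (hC _ (hS γ)).2.2.2.trans_lt (max_lt hgt (mk_image_le.trans_lt ?_))
      have hIio : #(Iio γ) < #M := by simpa using mk_Iio_lt γ (by simp)
      rw [← Iio_insert]
      exact (mk_insert_le).trans_lt (add_lt_of_lt hgt.le hIio (one_lt_aleph0.trans hgt))
    choose f hf using fun γ => ih _ (hcard γ) (hC _ (hS γ)).2.2.1 rfl
    have hN := fun γ => (hC _ (hS γ)).2.2.1
    have hmono : Monotone fun γ => C (S γ) := hCmono.comp hSmono
    have huniv : chainFamily (fun γ => C (S γ)) univ = M := by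
      apply Subset.antisymm
      · rintro W (hW | hW)
        · rw [mem_singleton_iff.1 hW]; exact hM.top_mem
        · obtain ⟨γ, -, hγ⟩ := mem_iUnion₂.1 hW
          exact (hC _ (hS γ)).2.1 hγ
      · intro W hW
        refine subset_chainFamily (mem_univ (e.symm ⟨W, hW⟩)) ((hC _ (hS _)).1 ?_)
        exact ⟨_, mem_Iic.2 le_rfl, by simp⟩
    rw [← huniv]
    exact exists_isRelMetric_chain hmono (fun γ => (hN γ).isReducingFamily hσ)
      (isReducingFamily_chainFamily hσ hmono hN) hf

theorem isStrategyClosed_ne_bot [RegularSpace X] [Nonempty X] (hσ : IsWinningStrategy σ) :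
    IsStrategyClosed σ {U | U ≠ ⊥} where
  top_mem := top_ne_bot
  ne_bot _ hU := hU
  inf_mem U _ V _ hUV h := hUV (disjoint_iff.2 h)
  exists_shrink W hW := by
    obtain ⟨x, hx⟩ := (Opens.ne_bot_iff_nonempty _).1 hW
    obtain ⟨t, ht, htc, htW⟩ := exists_mem_nhds_isClosed_subset (W.isOpen.mem_nhds hx)
    exact ⟨⟨interior t, isOpen_interior⟩,
      (Opens.ne_bot_iff_nonempty _).2 ⟨x, mem_interior_iff_mem_nhds.2 ht⟩,
      (closure_minimal interior_subset htc).trans htW⟩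
  strategy_mem n s _ := (Opens.ne_bot_iff_nonempty _).2 (hσ.nonempty n s)

end StrategyClosed

/-! ### From a relative metric to a quasi κ-metric -/

section QuasiKappaMetric

variable {X : Type u} [TopologicalSpace X]

/-- The interior of a set, as an open set. -/
def interiorOpens (C : Set X) : Opens X := ⟨interior C, isOpen_interior⟩

theorem IsRelMetric.isQuasiKappaMetric {h : Opens X → X → ℝ≥0∞}
    (hh : IsRelMetric {U | U ≠ ⊥} h) :
    IsQuasiKappaMetric fun x C => (h (interiorOpens C) x).toReal where
  nonneg _ _ _ := ENNReal.toReal_nonneg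
  K1star C hC := by
    have hcont := hh.continuous (interiorOpens C)
    have hclosed : IsClosed {x | h (interiorOpens C) x = 0} := isClosed_eq hcont continuous_const
    refine ⟨{x | h (interiorOpens C) x = 0}ᶜ, hclosed.isOpen_compl, compl_subset_compl.2 ?_,
      fun x hx => ?_, fun x => ?_⟩
    · exact (show closure (interior C) = C from hC).symm.subset.trans
        (closure_minimal (fun x hx => hh.zero _ x hx) hclosed)
    · rw [mem_closure_iff]
      intro O hO hxO
      have hCc : IsOpen Cᶜ := by
        rw [← (show closure (interior C) = C from hC)]
        exact isClosed_closure.isOpen_compl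
      -- Positivity inside `O ∩ Cᶜ` yields a point of `O` outside the zero set, which is the density
      -- required by K1*.
      obtain ⟨W', hW', hle, ε, hε, hlt⟩ := hh.pos (interiorOpens C) ⟨O ∩ Cᶜ, hO.inter hCc⟩
        ((Opens.ne_bot_iff_nonempty _).2 ⟨x, hxO, hx⟩)
        (Opens.coe_disjoint.1 (disjoint_compl_left.mono inter_subset_right interior_subset))
      obtain ⟨y, hy⟩ := (Opens.ne_bot_iff_nonempty _).1 hW'
      exact ⟨y, (hle hy).1, (hε.trans (hlt y hy)).ne'⟩
    · rw [compl_compl, mem_ofPred_eq, ENNReal.toReal_eq_zero_iff]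
      exact or_iff_left ((hh.le_one _ x).trans_lt ENNReal.one_lt_top).ne
  K2 C C' _ _ hCC' x := ENNReal.toReal_mono ((hh.le_one _ x).trans_lt ENNReal.one_lt_top).ne
    (hh.anti_le (interior_mono hCC') x)
  K3 C _ := ENNReal.continuousOn_toReal.comp_continuous (hh.continuous _)
    fun x => ((hh.le_one _ x).trans_lt ENNReal.one_lt_top).ne
  K4 ι _ _ _ C hC hmono x := by
    have htop : ∀ U, h U x ≠ ⊤ := fun U => ((hh.le_one U x).trans_lt ENNReal.one_lt_top).ne
    refine ⟨?_, fun b hb => ?_⟩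
    · rintro _ ⟨i, rfl⟩
      exact ENNReal.toReal_mono (htop _) (hh.anti_le
        (interior_mono ((subset_iUnion C i).trans subset_closure)) x)
    by_contra! hlt
    set 𝒟 : Set (Opens X) := range fun i => interiorOpens (C i)
    -- The interior of the closed union may exceed `sSup 𝒟`, but an open set disjoint from `sSup 𝒟`
    -- is disjoint from it as well, which is all that `anti` asks for.
    have hle : h (sSup 𝒟) x ≤ h (interiorOpens (closure (⋃ i, C i))) x := by
      refine hh.anti _ _ (fun W _ hW => ?_) x
      have hW' : ∀ i, Disjoint (W : Set X) (C i) := fun i => by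
        rw [← (show closure (interior (C i)) = C i from hC i)]
        exact (Opens.coe_disjoint.2 (disjoint_sSup_iff.1 hW _ ⟨i, rfl⟩)).closure_right W.isOpen
      exact Opens.coe_disjoint.1 (((disjoint_iUnion_right.2 hW').closure_right W.isOpen).mono_right
        interior_subset)
    have hbpos : 0 < b := ENNReal.toReal_nonneg.trans_lt hlt
    obtain ⟨_, ⟨i, rfl⟩, hi⟩ := hh.usc 𝒟 (range_nonempty _)
      (directedOn_range.2 (Monotone.directed_le (f := fun i => interiorOpens (C i))
        fun i j hij => interior_mono (hmono hij))) x
      (ENNReal.ofReal b) (hle.trans_lt ((ENNReal.lt_ofReal_iff_toReal_lt (htop _)).2 hlt))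
    exact (hb ⟨i, rfl⟩).not_gt
      ((ENNReal.lt_ofReal_iff_toReal_lt (htop _)).1 hi.self_of_nhds)

end QuasiKappaMetric

theorem theorem1p4 (X : Type u) [TopologicalSpace X] [CompactSpace X] [T2Space X] [Nonempty X] :
    IFavorable X ↔ QuasiKappaMetrizable X := by
  refine ⟨fun ⟨σ, hσ⟩ => ?_, QuasiKappaMetrizable.iFavorable⟩
  obtain ⟨h, hh⟩ := (isStrategyClosed_ne_bot hσ).exists_isRelMetric hσ
  exact ⟨_, hh.isQuasiKappaMetric⟩
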